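/- **Setting.** A *strong proximity lattice* is a distributive lattice $S$ with $0,1$ together with a relation $\prec$ on $S$ such that $\prec\circ\prec\;=\;\prec$; for every $b$ the set $\{a\mid a\prec b\}$ is an ideal and for every $a$ the set $\{b\mid a\prec b\}$ is a filter; $a\prec 0$ implies $a=0$; $1\prec a$ implies $a=1$; if $a\prec b\vee c$ then $a\le b'\vee c'$ for some $b'\prec b$, $c'\prec c$; and if $b\wedge c\prec a$ then $b'\wedge c'\le a$ for some $b'\succ b$, $c'\succ c$. Its *dual* $S^{d}$ is the opposite lattice with the relation $\succ$. An *entailment relation* on a set $S$ is a relation $\vdash$ between finite subsets of $S$ with $a\vdash a$; $A\vdash B\Rightarrow A'\cup A\vdash B\cup B'$; and $(A\vdash B\cup\{a\}$ and $\{a\}\cup A\vdash B)\Rightarrow A\vdash B$. A *strong continuous entailment relation* $(S,\vdash,\prec)$ is an entailment relation with an idempotent relation $\prec$ on $S$ such that for all finite $A,B$: $\exists A'\,(A\prec_U A'\vdash B)\iff\exists B'\,(A\vdash B'\prec_L B)$, where $A\prec_U B$ means $\forall b\in B\,\exists a\in A\,(a\prec b)$ and $A\prec_L B$ means $\forall a\in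 A\,\exists b\in B\,(a\prec b)$. Write $A\ll_{\vdash}B$ for the condition $\exists A'\,(A\prec_UA'\vdash B)$. The *dual* $(S,\vdash,\prec)^{d}$ is $S$ with the opposites of $\vdash$ and $\prec$. For a finite set $\mathcal U$ of finite sets let $\mathcal U^{*}$ be the set of all unions $\bigcup_{A\in\mathcal U}C_A$ with $\emptyset\ne C_A\subseteq A$ finite, and for a relation $r$ between finite subsets put $\mathcal U\,\widetilde r\,\mathcal V\iff\forall A\in\mathcal U\,\forall B\in\mathcal V^{*}\,(A\,r\,B)$. The *cut composition* is $A\,(s\cdot r)\,C\iff\exists\mathcal V\,[\forall B'\in\mathcal V^{*}\,(A\,r\,B')\ \&\ \forall B\in\mathcal V\,(B\,s\,C)]$, with $\mathcal V$ ranging over finite sets of finite sets. A *join-preserving proximity map* $(S,\vdash,\prec)\to(S',\vdash',\prec')$ is a relation $r$ between finite subsets of $S$ and of $S'$ such that $A\,r\,B$ implies $(A\cup A')\,r\,(B\cup B')$; ${\ll_{\vdash'}}\cdot r=r=r\cdot{\ll_{\vdash}}$; and whenever $A\,r\,B$ there is a finite set $\mathcal U$ of finite subsets of $S$ with $\{A\}\,\widetilde{\vdash}\,\mathcal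 U$ and $\forall A'\in\mathcal U\,\exists b\in B\,(A'\,r\,\{b\})$. Strong continuous entailment relations and these maps form a category, with cut composition as composition and $\ll_{\vdash}$ as identity; $\cong$ denotes isomorphism in it. For $X=(S,\vdash,\prec)$ let $F(X)$ be the strong proximity lattice of finite sets of finite subsets of $S$, ordered by $\widetilde{\vdash}$ (with elements identified when each is below the other), with $0=\emptyset$, $1=\{\emptyset\}$, $\mathcal U\vee\mathcal V=\mathcal U\cup\mathcal V$, $\mathcal U\wedge\mathcal V=\{A\cup B\mid A\in\mathcal U,B\in\mathcal V\}$, and with the relation $\widetilde{\ll_{\vdash}}$. For a strong proximity lattice $S=(S,\prec)$ define strong continuous entailment relations on the set $S$, where each entailment relation is the smallest one containing the listed axioms: - $\Sigma(S)=(S,\vdash_\Sigma,\succ)$: $\ \vdash 0$; $\ a,b\vdash a\vee b$; $\ a\vdash b$ if $b\le a$. - $\mathrm P_U(S)=(S,\vdash_U,\prec)$: $\ \vdash 1$; $\ a,b\vdash a\wedge b$; $\ a\vdash b$ if $a\le b$. - $\mathrm P_L(S)=(S,\vdash_L,\prec)$: $\ 0\vdash$; $\ a\vee b\vdash a,b$;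 $\ a\vdash b$ if $a\le b$. - $\mathrm P_D(S)=(S,\vdash_D,\prec)$: $\ a\vdash b$ if $a\le b$. Composites such as $\mathrm P_L(\Sigma(S))$ mean $\mathrm P_L(F(\Sigma(S)))$. **Statement.** For every strong proximity lattice $S$ there are isomorphisms of strong continuous entailment relations 1. $\mathrm P_L(\Sigma(S))\cong\Sigma(\mathrm P_U(S))$, 2. $\mathrm P_L(\mathrm P_U(S))\cong\mathrm P_D(S)$, 3. $\mathrm P_D(S)^{d}\cong\mathrm P_D(S^{d})$, 4. $\Sigma(\Sigma(S))^{d}\cong\Sigma(\Sigma(S^{d}))$. -/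

import Mathlib

universe u v w

section FiniteSubsets

variable {S : Type u} {T : Type v} {R : Type w}

open scoped Classical in
/-- `𝒰^*`: it consists of the unions `⋃_{A ∈ 𝒰} C_A` with each `C_A` an inhabited subset of `A`,
that is, of those `B ⊆ ⋃ 𝒰` that meet every `A ∈ 𝒰`. -/
noncomputable def finStar (U : Finset (Finset S)) : Finset (Finset S) :=
  (U.biUnion id).powerset.filter fun B => ∀ A ∈ U, (A ∩ B).Nonempty

theorem finStar_empty : finStar (∅ : Finset (Finset S)) = {∅} := by
  classical
  ext B
  simp [finStar]

open scoped Classical in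
theorem mem_finStar_insert (U : Finset (Finset S)) (A D : Finset S) :
    D ∈ finStar (insert A U) ↔
      ∃ B ∈ finStar U, ∃ C : Finset S, C ⊆ A ∧ C.Nonempty ∧ D = B ∪ C := by
  constructor
  · intro h
    simp only [finStar, Finset.mem_filter, Finset.mem_powerset, Finset.mem_insert,
      forall_eq_or_imp] at h
    obtain ⟨h1, h2, h3⟩ := h
    refine ⟨D ∩ U.biUnion id, ?_, A ∩ D, Finset.inter_subset_left, h2, ?_⟩
    · simp only [finStar, Finset.mem_filter, Finset.mem_powerset]
      refine ⟨Finset.inter_subset_right, fun X hX => ?_⟩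
      obtain ⟨x, hx⟩ := h3 X hX
      rw [Finset.mem_inter] at hx
      refine ⟨x, ?_⟩
      simp only [Finset.mem_inter, Finset.mem_biUnion, id]
      exact ⟨hx.1, hx.2, X, hX, hx.1⟩
    · ext x
      have := @h1 x
      simp only [Finset.mem_biUnion, Finset.mem_insert, id, exists_eq_or_imp] at this
      simp only [Finset.mem_union, Finset.mem_inter, Finset.mem_biUnion, id]
      constructor
      · intro hx
        rcases this hx with hA | hU
        · exact Or.inr ⟨hA, hx⟩
        · exact Or.inl ⟨hx, hU⟩
      · rintro (hx | hx)
        · exact hx.1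
        · exact hx.2
  · rintro ⟨B, hB, C, hC, ⟨c, hc⟩, rfl⟩
    simp only [finStar, Finset.mem_filter, Finset.mem_powerset] at hB ⊢
    refine ⟨?_, ?_⟩
    · intro x hx
      rcases Finset.mem_union.1 hx with hx | hx
      · have := hB.1 hx
        simp only [Finset.mem_biUnion, Finset.mem_insert, id] at this ⊢
        obtain ⟨X, hX, hxX⟩ := this
        exact ⟨X, Or.inr hX, hxX⟩
      · simp only [Finset.mem_biUnion, Finset.mem_insert, id]
        exact ⟨A, Or.inl rfl, hC hx⟩
    · intro X hX
      rcases Finset.mem_insert.1 hX with rfl | hX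
      · exact ⟨c, by simp [hC hc, hc]⟩
      · obtain ⟨x, hx⟩ := hB.2 X hX
        rw [Finset.mem_inter] at hx
        exact ⟨x, by simp [hx.1, hx.2]⟩

/-- `A ≺_U B`. -/
def PrecU (prec : S → S → Prop) (A B : Finset S) : Prop := ∀ b ∈ B, ∃ a ∈ A, prec a b

/-- `A ≺_L B`. -/
def PrecL (prec : S → S → Prop) (A B : Finset S) : Prop := ∀ a ∈ A, ∃ b ∈ B, prec a b

/-- The extension `r~` of `r` to finite sets of finite sets. -/
def finExt (r : Finset S → Finset T → Prop) (U : Finset (Finset S)) (V : Finset (Finset T)) :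
    Prop :=
  ∀ A ∈ U, ∀ B ∈ finStar V, r A B

open scoped Classical in
def IsUpperRel (r : Finset S → Finset T → Prop) : Prop :=
  ∀ A A' B B', r A B → r (A ∪ A') (B ∪ B')

/-- The cut composition `s · r` (first `r`, then `s`). -/
def cutComp (s : Finset T → Finset R → Prop) (r : Finset S → Finset T → Prop)
    (A : Finset S) (C : Finset R) : Prop :=
  ∃ V : Finset (Finset T), (∀ B' ∈ finStar V, r A B') ∧ ∀ B ∈ V, s B C

end FiniteSubsets

/-! ### Strong proximity lattices -/

/-- A proximity relation between (bounded) distributive lattices: every `r⁻ b` is an ideal and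
every `r a` is a filter. -/
structure IsProximityRel {S : Type u} {T : Type v} [DistribLattice S] [BoundedOrder S]
    [DistribLattice T] [BoundedOrder T] (r : S → T → Prop) : Prop where
  bot_left : ∀ b, r ⊥ b
  sup_left : ∀ a a' b, r a b → r a' b → r (a ⊔ a') b
  down : ∀ a a' b, a' ≤ a → r a b → r a' b
  top_right : ∀ a, r a ⊤
  inf_right : ∀ a b b', r a b → r a b' → r a (b ⊓ b')
  up : ∀ a b b', b ≤ b' → r a b → r a b'

structure IsJoinPreservingRel {S : Type u} {T : Type v} [DistribLattice S] [BoundedOrder S]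
    [DistribLattice T] [BoundedOrder T] (r : S → T → Prop) : Prop where
  prox_zero : ∀ a, r a ⊥ → a = ⊥
  prox_sup : ∀ a b c, r a (b ⊔ c) → ∃ b' c', a ≤ b' ⊔ c' ∧ r b' b ∧ r c' c

/-- The structure of a strong proximity lattice on a bounded distributive lattice. -/
structure StrongProxLat (S : Type u) [DistribLattice S] [BoundedOrder S] where
  prec : S → S → Prop
  isProximityRel : IsProximityRel prec
  idem : ∀ a b, (∃ c, prec a c ∧ prec c b) ↔ prec a b
  isJoinPreservingRel : IsJoinPreservingRel prec
  prox_one : ∀ a, prec ⊤ a → a = ⊤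
  prox_inf : ∀ a b c, prec (b ⊓ c) a → ∃ b' c', prec b b' ∧ prec c c' ∧ b' ⊓ c' ≤ a

/-- The dual strong proximity lattice: the opposite lattice with the opposite relation. -/
def StrongProxLat.dual {S : Type u} [DistribLattice S] [BoundedOrder S] (P : StrongProxLat S) :
    StrongProxLat Sᵒᵈ where
  prec a b := P.prec (OrderDual.ofDual b) (OrderDual.ofDual a)
  isProximityRel :=
    { bot_left := fun b => P.isProximityRel.top_right _
      sup_left := fun a a' b h h' => P.isProximityRel.inf_right _ _ _ h h'
      down := fun a a' b h h' => P.isProximityRel.up _ _ _ h h'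
      top_right := fun a => P.isProximityRel.bot_left _
      inf_right := fun a b b' h h' => P.isProximityRel.sup_left _ _ _ h h'
      up := fun a b b' h h' => P.isProximityRel.down _ _ _ h h' }
  idem a b := by
    rw [← P.idem]
    exact ⟨fun ⟨c, h, h'⟩ => ⟨OrderDual.ofDual c, h', h⟩,
      fun ⟨c, h, h'⟩ => ⟨OrderDual.toDual c, h', h⟩⟩
  isJoinPreservingRel :=
    { prox_zero := fun a h => P.prox_one _ h
      prox_sup := fun a b c h => by
        obtain ⟨b', c', h1, h2, h3⟩ := P.prox_inf _ _ _ h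
        exact ⟨b', c', h3, h1, h2⟩ }
  prox_one a h := P.isJoinPreservingRel.prox_zero _ h
  prox_inf a b c h := by
    obtain ⟨b', c', h1, h2, h3⟩ := P.isJoinPreservingRel.prox_sup _ _ _ h
    exact ⟨b', c', h2, h3, h1⟩

/-! ### Entailment relations -/

open scoped Classical in
structure EntRel (S : Type u) where
  rel : Finset S → Finset S → Prop
  refl : ∀ a, rel {a} {a}
  mono : ∀ A A' B B', rel A B → rel (A' ∪ A) (B ∪ B')
  cut : ∀ A B a, rel A (B ∪ {a}) → rel ({a} ∪ A) B → rel A B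

open scoped Classical in
/-- The smallest relation containing the axioms `ax` and closed under the rules of an entailment
relation. -/
inductive EntGenRel {S : Type u} (ax : Finset S → Finset S → Prop) : Finset S → Finset S → Prop
  | ax (A B : Finset S) : ax A B → EntGenRel ax A B
  | refl (a : S) : EntGenRel ax {a} {a}
  | mono (A A' B B' : Finset S) : EntGenRel ax A B → EntGenRel ax (A' ∪ A) (B ∪ B')
  | cut (A B : Finset S) (a : S) :
      EntGenRel ax A (B ∪ {a}) → EntGenRel ax ({a} ∪ A) B → EntGenRel ax A B

/-- The entailment relation generated by a set of axioms. -/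
def EntRel.generate {S : Type u} (ax : Finset S → Finset S → Prop) : EntRel S where
  rel := EntGenRel ax
  refl := EntGenRel.refl
  mono := EntGenRel.mono
  cut := EntGenRel.cut

namespace EntRel

variable {S : Type u} (E : EntRel S)

theorem weaken {A A' B B' : Finset S} (hA : A ⊆ A') (hB : B ⊆ B') (h : E.rel A B) :
    E.rel A' B' := by
  classical
  have := E.mono A A' B B' h
  convert this using 1
  · exact (Finset.union_eq_left.2 hA).symm
  · exact (Finset.union_eq_right.2 hB).symm

theorem of_mem {A B : Finset S} {a : S} (hA : a ∈ A) (hB : a ∈ B) : E.rel A B :=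
  E.weaken (Finset.singleton_subset_iff.2 hA) (Finset.singleton_subset_iff.2 hB) (E.refl a)

open scoped Classical in
theorem cut_right (A B C : Finset S) (h : E.rel A (B ∪ C))
    (h' : ∀ c ∈ C, E.rel ({c} ∪ A) B) : E.rel A B := by
  induction C using Finset.induction_on with
  | empty => simpa using h
  | insert c C _ ih =>
    refine ih ?_ fun x hx => h' x (Finset.mem_insert_of_mem hx)
    refine E.cut _ _ c (E.weaken subset_rfl ?_ h) (E.weaken subset_rfl ?_ (h' c (by simp)))
    · intro x; simp
    · exact Finset.subset_union_left

open scoped Classical in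
theorem cut_left (A B C : Finset S) (h : E.rel (A ∪ C) B)
    (h' : ∀ c ∈ C, E.rel A (B ∪ {c})) : E.rel A B := by
  induction C using Finset.induction_on with
  | empty => simpa using h
  | insert c C _ ih =>
    refine ih ?_ fun x hx => h' x (Finset.mem_insert_of_mem hx)
    refine E.cut _ _ c (E.weaken Finset.subset_union_left subset_rfl (h' c (by simp)))
      (E.weaken ?_ subset_rfl h)
    intro x; simp

open scoped Classical in
/-- If `p` is closed under supersets, `𝒱^*` may be replaced by the larger collection of
all finite sets that meet every member of `𝒱`. -/
theorem forall_finStar {V : Finset (Finset S)} {p : Finset S → Prop}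
    (hp : ∀ B B', B ⊆ B' → p B → p B') :
    (∀ B ∈ finStar V, p B) ↔ ∀ B, (∀ A ∈ V, ∃ a ∈ A, a ∈ B) → p B := by
  constructor
  · intro h B hB
    refine hp (B ∩ V.biUnion id) B Finset.inter_subset_left (h _ ?_)
    simp only [finStar, Finset.mem_filter, Finset.mem_powerset]
    refine ⟨Finset.inter_subset_right, fun A hA => ?_⟩
    obtain ⟨a, ha, haB⟩ := hB A hA
    refine ⟨a, ?_⟩
    simp only [Finset.mem_inter, Finset.mem_biUnion, id]
    exact ⟨ha, haB, A, hA, ha⟩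
  · intro h B hB
    simp only [finStar, Finset.mem_filter, Finset.mem_powerset] at hB
    refine h B fun A hA => ?_
    obtain ⟨a, ha⟩ := hB.2 A hA
    exact ⟨a, Finset.mem_inter.1 ha⟩

theorem finExt_iff {U V : Finset (Finset S)} :
    finExt E.rel U V ↔ ∀ A ∈ U, ∀ B, (∀ C ∈ V, ∃ c ∈ C, c ∈ B) → E.rel A B :=
  forall₂_congr fun _ _ => forall_finStar fun _ _ h h' => E.weaken subset_rfl h h'

open scoped Classical in
theorem cut_finset (A B : Finset S) (V : Finset (Finset S))
    (h : ∀ C, (∀ D ∈ V, ∃ d ∈ D, d ∈ C) → E.rel A (B ∪ C))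
    (h' : ∀ D ∈ V, E.rel (A ∪ D) B) : E.rel A B := by
  induction V using Finset.induction_on with
  | empty => simpa using h ∅ (by simp)
  | insert D V _ ih =>
    refine ih (fun C hC => ?_) fun X hX => h' X (Finset.mem_insert_of_mem hX)
    refine E.cut_left A (B ∪ C) D
      (E.weaken subset_rfl Finset.subset_union_left (h' D (by simp))) fun d hd => ?_
    have := h (C ∪ {d}) (by
      intro X hX
      rcases Finset.mem_insert.1 hX with rfl | hX
      · exact ⟨d, hd, by simp⟩
      · obtain ⟨x, hx, hxC⟩ := hC X hX
        exact ⟨x, hx, by simp [hxC]⟩)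
    rwa [← Finset.union_assoc] at this

theorem cut_finExt {U : Finset (Finset S)} {A B : Finset S}
    (h : ∀ C, (∀ D ∈ U, ∃ d ∈ D, d ∈ C) → E.rel A C) (h' : ∀ D ∈ U, E.rel D B) :
    E.rel A B := by
  classical
  exact E.cut_finset A B U (fun C hC => E.weaken subset_rfl Finset.subset_union_right (h C hC))
    fun D hD => E.weaken Finset.subset_union_right subset_rfl (h' D hD)

theorem finExt_of_subset {U V : Finset (Finset S)}
    (h : ∀ A ∈ U, ∃ B ∈ V, B ⊆ A) : finExt E.rel U V := by
  rw [finExt_iff]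
  intro A hA B hB
  obtain ⟨C, hC, hCA⟩ := h A hA
  obtain ⟨c, hc, hcB⟩ := hB C hC
  exact E.of_mem (hCA hc) hcB

theorem finExt_trans {U V W : Finset (Finset S)} (h : finExt E.rel U V)
    (h' : finExt E.rel V W) : finExt E.rel U W := by
  rw [finExt_iff] at *
  exact fun A hA B hB => E.cut_finExt (h A hA) fun D hD => h' D hD B hB

/-- Equality of finite sets of finite sets, modulo `⊢`. -/
def latSetoid : Setoid (Finset (Finset S)) where
  r U V := finExt E.rel U V ∧ finExt E.rel V U
  iseqv :=
    { refl := fun _ => ⟨E.finExt_of_subset fun A hA => ⟨A, hA, subset_rfl⟩,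
        E.finExt_of_subset fun A hA => ⟨A, hA, subset_rfl⟩⟩
      symm := fun h => ⟨h.2, h.1⟩
      trans := fun h h' => ⟨E.finExt_trans h.1 h'.1, E.finExt_trans h'.2 h.2⟩ }

/-- The underlying set of the distributive lattice determined by an entailment relation. -/
def Lat : Type u := Quotient E.latSetoid

open scoped Classical in
/-- `{A ∪ B | A ∈ 𝒰, B ∈ 𝒱}`. -/
noncomputable def finMeet (U V : Finset (Finset S)) : Finset (Finset S) :=
  Finset.image₂ (fun A B => A ∪ B) U V

open scoped Classical in
theorem finExt_union_left {U V W : Finset (Finset S)} :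
    finExt E.rel (U ∪ V) W ↔ finExt E.rel U W ∧ finExt E.rel V W := by
  simp only [finExt, Finset.mem_union, or_imp, forall_and]

theorem meets_finMeet {U V : Finset (Finset S)} {B : Finset S}
    (h : ∀ C ∈ finMeet U V, ∃ c ∈ C, c ∈ B) :
    (∀ C ∈ U, ∃ c ∈ C, c ∈ B) ∨ ∀ C ∈ V, ∃ c ∈ C, c ∈ B := by
  classical
  by_contra hcon
  simp only [not_or, not_forall] at hcon
  obtain ⟨⟨C, hC, hC'⟩, D, hD, hD'⟩ := hcon
  obtain ⟨c, hc, hcB⟩ := h (C ∪ D) (Finset.mem_image₂_of_mem hC hD)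
  rcases Finset.mem_union.1 hc with hc | hc
  · exact hC' ⟨c, hc, hcB⟩
  · exact hD' ⟨c, hc, hcB⟩

theorem finMeet_le_left (U V : Finset (Finset S)) : finExt E.rel (finMeet U V) U := by
  classical
  refine E.finExt_of_subset fun A hA => ?_
  obtain ⟨B, hB, C, hC, rfl⟩ := Finset.mem_image₂.1 hA
  exact ⟨B, hB, Finset.subset_union_left⟩

theorem finMeet_le_right (U V : Finset (Finset S)) : finExt E.rel (finMeet U V) V := by
  classical
  refine E.finExt_of_subset fun A hA => ?_
  obtain ⟨B, hB, C, hC, rfl⟩ := Finset.mem_image₂.1 hA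
  exact ⟨C, hC, Finset.subset_union_right⟩

theorem le_finMeet {U V W : Finset (Finset S)} (h : finExt E.rel W U)
    (h' : finExt E.rel W V) : finExt E.rel W (finMeet U V) := by
  rw [finExt_iff] at *
  intro A hA B hB
  rcases meets_finMeet hB with hB | hB
  · exact h A hA B hB
  · exact h' A hA B hB

open scoped Classical in
/-- The distributive lattice determined by an entailment relation: the order is induced by the
extension of `⊢`, joins by unions, and meets by `{A ∪ B | A ∈ 𝒰, B ∈ 𝒱}`. -/
noncomputable instance instDistribLatticeLat : DistribLattice E.Lat where
  le := Quotient.lift₂ (fun U V => finExt E.rel U V) fun _ _ _ _ h h' =>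
    propext ⟨fun H => E.finExt_trans h.2 (E.finExt_trans H h'.1),
      fun H => E.finExt_trans h.1 (E.finExt_trans H h'.2)⟩
  le_refl := by
    rintro ⟨U⟩
    exact E.finExt_of_subset fun A hA => ⟨A, hA, subset_rfl⟩
  le_trans := by
    rintro ⟨U⟩ ⟨V⟩ ⟨W⟩ h h'
    exact E.finExt_trans h h'
  le_antisymm := by
    rintro ⟨U⟩ ⟨V⟩ h h'
    exact Quotient.sound ⟨h, h'⟩
  sup := Quotient.map₂ (fun U V => U ∪ V) fun U U' h V V' h' => by
    constructor
    · refine E.finExt_union_left.2 ⟨E.finExt_trans h.1 (E.finExt_of_subset ?_),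
        E.finExt_trans h'.1 (E.finExt_of_subset ?_)⟩
      · exact fun A hA => ⟨A, Finset.mem_union_left _ hA, subset_rfl⟩
      · exact fun A hA => ⟨A, Finset.mem_union_right _ hA, subset_rfl⟩
    · refine E.finExt_union_left.2 ⟨E.finExt_trans h.2 (E.finExt_of_subset ?_),
        E.finExt_trans h'.2 (E.finExt_of_subset ?_)⟩
      · exact fun A hA => ⟨A, Finset.mem_union_left _ hA, subset_rfl⟩
      · exact fun A hA => ⟨A, Finset.mem_union_right _ hA, subset_rfl⟩
  le_sup_left := by
    rintro ⟨U⟩ ⟨V⟩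
    exact E.finExt_of_subset fun A hA => ⟨A, Finset.mem_union_left _ hA, subset_rfl⟩
  le_sup_right := by
    rintro ⟨U⟩ ⟨V⟩
    exact E.finExt_of_subset fun A hA => ⟨A, Finset.mem_union_right _ hA, subset_rfl⟩
  sup_le := by
    rintro ⟨U⟩ ⟨V⟩ ⟨W⟩ h h'
    exact E.finExt_union_left.2 ⟨h, h'⟩
  inf := Quotient.map₂ finMeet fun U U' h V V' h' =>
    ⟨E.le_finMeet (E.finExt_trans (E.finMeet_le_left _ _) h.1)
        (E.finExt_trans (E.finMeet_le_right _ _) h'.1),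
      E.le_finMeet (E.finExt_trans (E.finMeet_le_left _ _) h.2)
        (E.finExt_trans (E.finMeet_le_right _ _) h'.2)⟩
  inf_le_left := by
    rintro ⟨U⟩ ⟨V⟩
    exact E.finMeet_le_left U V
  inf_le_right := by
    rintro ⟨U⟩ ⟨V⟩
    exact E.finMeet_le_right U V
  le_inf := by
    rintro ⟨U⟩ ⟨V⟩ ⟨W⟩ h h'
    exact E.le_finMeet h h'
  le_sup_inf := by
    rintro ⟨U⟩ ⟨V⟩ ⟨W⟩
    refine E.finExt_of_subset fun X hX => ?_
    obtain ⟨A, hA, B, hB, rfl⟩ := Finset.mem_image₂.1 hX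
    rcases Finset.mem_union.1 hA with hA | hA
    · exact ⟨A, Finset.mem_union_left _ hA, Finset.subset_union_left⟩
    · rcases Finset.mem_union.1 hB with hB | hB
      · exact ⟨B, Finset.mem_union_left _ hB, Finset.subset_union_right⟩
      · exact ⟨A ∪ B, Finset.mem_union_right _ (Finset.mem_image₂_of_mem hA hB), subset_rfl⟩

/-- The least element is (the class of) `∅`, the greatest one is `{∅}`. -/
instance instBoundedOrderLat : BoundedOrder E.Lat where
  bot := Quotient.mk _ ∅
  bot_le := by
    rintro ⟨U⟩
    exact E.finExt_of_subset (by simp)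
  top := Quotient.mk _ {∅}
  le_top := by
    rintro ⟨U⟩
    exact E.finExt_of_subset fun A _ => ⟨∅, by simp⟩

end EntRel

/-! ### Strong continuous entailment relations -/

/-- A strong continuous entailment relation on `S`. -/
structure SContEnt (S : Type u) extends EntRel S where
  prec : S → S → Prop
  idem : ∀ a b, (∃ c, prec a c ∧ prec c b) ↔ prec a b
  cont : ∀ A B, (∃ A', PrecU prec A A' ∧ rel A' B) ↔ ∃ B', rel A B' ∧ PrecL prec B' B

namespace SContEnt

variable {S : Type u} {T : Type v}

/-- `≪_⊢`, i.e. `≺_U` followed by `⊢`. -/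
def ll (X : SContEnt S) (A B : Finset S) : Prop := ∃ A', PrecU X.prec A A' ∧ X.rel A' B

/-- The dual: opposite entailment and opposite `≺`. -/
def dual (X : SContEnt S) : SContEnt S where
  rel A B := X.rel B A
  refl := X.refl
  mono A A' B B' h := by
    classical
    exact X.toEntRel.weaken Finset.subset_union_left Finset.subset_union_right h
  cut A B a h h' := by
    classical
    exact X.cut B A a (by rwa [Finset.union_comm] at h') (by rwa [Finset.union_comm] at h)
  prec a b := X.prec b a
  idem a b := by
    rw [← X.idem]
    exact exists_congr fun c => and_comm
  cont A B := by
    have := X.cont B A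
    exact ⟨fun ⟨A', h1, h2⟩ =>
        let ⟨B', h3, h4⟩ := this.2 ⟨A', h2, h1⟩; ⟨B', h4, h3⟩,
      fun ⟨B', h1, h2⟩ =>
        let ⟨A', h3, h4⟩ := this.1 ⟨B', h2, h1⟩; ⟨A', h4, h3⟩⟩

/-- A join-preserving proximity map: a Karoubi morphism between the entailment systems `(S, ≪_⊢)`
and `(T, ≪_⊢')` which satisfies (JP). -/
structure IsJoinPresProxMap (X : SContEnt S) (Y : SContEnt T)
    (r : Finset S → Finset T → Prop) : Prop where
  upper : IsUpperRel r
  ll_comp : cutComp Y.ll r = r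
  comp_ll : cutComp r X.ll = r
  join_pres : ∀ A B, r A B → ∃ U : Finset (Finset S),
    finExt X.rel {A} U ∧ ∀ A' ∈ U, ∃ b ∈ B, r A' {b}

/-- Isomorphism in the category of strong continuous entailment relations and join-preserving
proximity maps, in which composition is cut composition and the identity on `X` is `X.ll`. -/
def Isomorphic (X : SContEnt S) (Y : SContEnt T) : Prop :=
  ∃ (r : Finset S → Finset T → Prop) (s : Finset T → Finset S → Prop),
    IsJoinPresProxMap X Y r ∧ IsJoinPresProxMap Y X s ∧
      cutComp s r = X.ll ∧ cutComp r s = Y.ll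

theorem ll_weaken (X : SContEnt S) {A B B' : Finset S} (hB : B ⊆ B') (h : X.ll A B) :
    X.ll A B' := by
  obtain ⟨A', h1, h2⟩ := h
  exact ⟨A', h1, X.toEntRel.weaken subset_rfl hB h2⟩

theorem finExt_ll_iff (X : SContEnt S) {U V : Finset (Finset S)} :
    finExt X.ll U V ↔ ∀ A ∈ U, ∀ B, (∀ C ∈ V, ∃ c ∈ C, c ∈ B) → X.ll A B :=
  forall₂_congr fun _ _ => EntRel.forall_finStar fun _ _ h h' => X.ll_weaken h h'

/-- `𝒰 ≪~ 𝒱` iff each `A ∈ 𝒰` satisfies `A ≺_U A'` for some `A'` with `{A'} ⊢~ 𝒱`. -/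
theorem finExt_ll_iff_left (X : SContEnt S) {U V : Finset (Finset S)} :
    finExt X.ll U V ↔ ∀ A ∈ U, ∃ A', PrecU X.prec A A' ∧ finExt X.rel {A'} V := by
  classical
  constructor
  · intro h A hA
    choose! f hf using h A hA
    refine ⟨(finStar V).biUnion f, fun b hb => ?_, fun C hC B hB => ?_⟩
    · obtain ⟨B, hB, hbB⟩ := Finset.mem_biUnion.1 hb
      exact (hf B hB).1 b hbB
    · rw [Finset.mem_singleton] at hC
      subst hC
      exact X.toEntRel.weaken (Finset.subset_biUnion_of_mem f hB) subset_rfl (hf B hB).2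
  · intro h A hA B hB
    obtain ⟨A', h1, h2⟩ := h A hA
    exact ⟨A', h1, h2 A' (by simp) B hB⟩

/-- The dual characterisation of `≪~`. -/
theorem finExt_ll_iff_right (X : SContEnt S) {U V : Finset (Finset S)} :
    finExt X.ll U V ↔ ∀ B, (∀ C ∈ V, ∃ c ∈ C, c ∈ B) →
      ∃ B', PrecL X.prec B' B ∧ ∀ A ∈ U, X.rel A B' := by
  classical
  rw [finExt_ll_iff]
  constructor
  · intro h B hB
    have : ∀ A ∈ U, ∃ B', X.rel A B' ∧ PrecL X.prec B' B := fun A hA =>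
      (X.cont A B).1 (h A hA B hB)
    choose! f hf using this
    refine ⟨U.biUnion f, fun b hb => ?_, fun A hA => ?_⟩
    · obtain ⟨A, hA, hbA⟩ := Finset.mem_biUnion.1 hb
      exact (hf A hA).2 b hbA
    · exact X.toEntRel.weaken subset_rfl (Finset.subset_biUnion_of_mem f hA) (hf A hA).1
  · intro h A hA B hB
    obtain ⟨B', h1, h2⟩ := h B hB
    exact (X.cont A B).2 ⟨B', h2 A hA, h1⟩

theorem finExt_ll_mono (X : SContEnt S) {U U' V V' : Finset (Finset S)}
    (h : finExt X.rel U' U) (h' : finExt X.ll U V) (h'' : finExt X.rel V V') :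
    finExt X.ll U' V' := by
  have h1 : finExt X.ll U' V := by
    rw [finExt_ll_iff_right] at h' ⊢
    rw [EntRel.finExt_iff] at h
    intro B hB
    obtain ⟨B', h1, h2⟩ := h' B hB
    exact ⟨B', h1, fun A hA => X.toEntRel.cut_finExt (h A hA) h2⟩
  rw [finExt_ll_iff_left] at h1 ⊢
  intro A hA
  obtain ⟨A', h2, h3⟩ := h1 A hA
  exact ⟨A', h2, X.toEntRel.finExt_trans h3 h''⟩

theorem precU_idem (X : SContEnt S) {A B : Finset S} :
    (∃ C, PrecU X.prec A C ∧ PrecU X.prec C B) ↔ PrecU X.prec A B := by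
  classical
  constructor
  · rintro ⟨C, h, h'⟩ b hb
    obtain ⟨c, hc, hcb⟩ := h' b hb
    obtain ⟨a, ha, hac⟩ := h c hc
    exact ⟨a, ha, (X.idem a b).1 ⟨c, hac, hcb⟩⟩
  · intro h
    have : ∀ b ∈ B, ∃ c, (∃ a ∈ A, X.prec a c) ∧ X.prec c b := fun b hb => by
      obtain ⟨a, ha, hab⟩ := h b hb
      obtain ⟨c, h1, h2⟩ := (X.idem a b).2 hab
      exact ⟨c, ⟨a, ha, h1⟩, h2⟩
    choose! f hf using this
    refine ⟨B.image f, fun c hc => ?_, fun b hb => ⟨f b, Finset.mem_image_of_mem f hb,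
      (hf b hb).2⟩⟩
    obtain ⟨b, hb, rfl⟩ := Finset.mem_image.1 hc
    exact (hf b hb).1

/-- The relation induced by `≪~` on the lattice determined by the entailment relation. -/
def latPrec (X : SContEnt S) : X.toEntRel.Lat → X.toEntRel.Lat → Prop :=
  Quotient.lift₂ (fun U V => finExt X.ll U V) fun _ _ _ _ h h' =>
    propext ⟨fun H => X.finExt_ll_mono h.2 H h'.1, fun H => X.finExt_ll_mono h.1 H h'.2⟩

theorem latPrec_isProximityRel (X : SContEnt S) : IsProximityRel X.latPrec where
  bot_left := by
    rintro ⟨V⟩ A hA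
    simp at hA
  sup_left := by
    classical
    rintro ⟨U⟩ ⟨U'⟩ ⟨V⟩ h h' A hA
    rcases Finset.mem_union.1 hA with hA | hA
    · exact h A hA
    · exact h' A hA
  down := by
    rintro ⟨U⟩ ⟨U'⟩ ⟨V⟩ h h'
    exact X.finExt_ll_mono h h' (X.toEntRel.latSetoid.refl V).1
  top_right := by
    rintro ⟨U⟩
    refine X.finExt_ll_iff.2 fun A hA B hB => ?_
    obtain ⟨c, hc, _⟩ := hB ∅ (by simp)
    simp at hc
  inf_right := by
    rintro ⟨U⟩ ⟨V⟩ ⟨V'⟩ h h'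
    refine X.finExt_ll_iff.2 fun A hA B hB => ?_
    rcases EntRel.meets_finMeet hB with hB | hB
    · exact X.finExt_ll_iff.1 h A hA B hB
    · exact X.finExt_ll_iff.1 h' A hA B hB
  up := by
    rintro ⟨U⟩ ⟨V⟩ ⟨V'⟩ h h'
    exact X.finExt_ll_mono (X.toEntRel.latSetoid.refl U).1 h' h

theorem latPrec_idem (X : SContEnt S) (a b : X.toEntRel.Lat) :
    (∃ c, X.latPrec a c ∧ X.latPrec c b) ↔ X.latPrec a b := by
  classical
  revert a b
  rintro ⟨U⟩ ⟨V⟩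
  constructor
  · rintro ⟨⟨W⟩, h, h'⟩
    refine X.finExt_ll_iff_left.2 fun A hA => ?_
    obtain ⟨A', h1, h2⟩ := X.finExt_ll_iff_left.1 h A hA
    have h3 : finExt X.ll {A'} V := X.finExt_ll_mono h2 h' (X.toEntRel.latSetoid.refl V).1
    obtain ⟨A'', h4, h5⟩ := X.finExt_ll_iff_left.1 h3 A' (by simp)
    exact ⟨A'', X.precU_idem.1 ⟨A', h1, h4⟩, h5⟩
  · intro h
    have : ∀ A ∈ U, ∃ C, PrecU X.prec A C ∧
        ∃ A', PrecU X.prec C A' ∧ finExt X.rel {A'} V := fun A hA => by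
      obtain ⟨A', h1, h2⟩ := X.finExt_ll_iff_left.1 h A hA
      obtain ⟨C, h3, h4⟩ := X.precU_idem.2 h1
      exact ⟨C, h3, A', h4, h2⟩
    choose! f hf using this
    refine ⟨Quotient.mk _ (U.image f), X.finExt_ll_iff_left.2 fun A hA => ?_,
      X.finExt_ll_iff_left.2 fun C hC => ?_⟩
    · refine ⟨f A, (hf A hA).1, X.toEntRel.finExt_of_subset fun B hB => ?_⟩
      rw [Finset.mem_singleton] at hB
      subst hB
      exact ⟨f A, Finset.mem_image_of_mem f hA, subset_rfl⟩
    · obtain ⟨A, hA, rfl⟩ := Finset.mem_image.1 hC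
      exact (hf A hA).2

theorem latPrec_isJoinPreservingRel (X : SContEnt S) : IsJoinPreservingRel X.latPrec where
  prox_zero := by
    rintro ⟨U⟩ h
    refine le_antisymm ?_ bot_le
    refine X.toEntRel.finExt_iff.2 fun A hA B hB => ?_
    obtain ⟨B', h1, h2⟩ := X.finExt_ll_iff_right.1 h ∅ (by simp)
    refine X.toEntRel.weaken subset_rfl (fun b hb => ?_) (h2 A hA)
    obtain ⟨c, hc, _⟩ := h1 b hb
    simp at hc
  prox_sup := by
    classical
    rintro ⟨U⟩ ⟨V⟩ ⟨W⟩ h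
    have h1 := X.finExt_ll_iff_right.1 h
    choose! f hf using h1
    let N : Finset S := (V ∪ W).biUnion id
    let G : Finset S := N.powerset.biUnion f
    let K : Finset (Finset S) → Finset (Finset S) := fun Z =>
      G.powerset.filter fun Y => ∃ A ∈ Z, PrecU X.prec Y A
    have hK : ∀ Z, finExt X.ll (K Z) Z := fun Z => X.finExt_ll_iff_left.2 fun Y hY => by
      obtain ⟨A, hA, hYA⟩ := (Finset.mem_filter.1 hY).2
      refine ⟨A, hYA, X.toEntRel.finExt_of_subset fun B hB => ⟨A, hA, ?_⟩⟩
      rw [Finset.mem_singleton.1 hB]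
    refine ⟨Quotient.mk _ (K V), Quotient.mk _ (K W), ?_, hK V, hK W⟩
    refine X.toEntRel.finExt_iff.2 fun A hA D hD => ?_
    let M : Finset S := N.filter fun e => ∀ g ∈ G, X.prec g e → g ∈ D
    have hM : ∀ C ∈ V ∪ W, ∃ c ∈ C, c ∈ M := by
      intro C hC
      by_contra hcon
      have h2 : PrecU X.prec (G \ D) C := by
        intro c hc
        by_contra hcon'
        refine hcon ⟨c, hc, Finset.mem_filter.2
          ⟨Finset.mem_biUnion.2 ⟨C, hC, hc⟩, fun g hg hgc => ?_⟩⟩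
        by_contra hgD
        exact hcon' ⟨g, Finset.mem_sdiff.2 ⟨hg, hgD⟩, hgc⟩
      have h3 : G \ D ∈ K V ∪ K W := by
        rcases Finset.mem_union.1 hC with hC | hC
        · exact Finset.mem_union_left _ (Finset.mem_filter.2
            ⟨Finset.mem_powerset.2 Finset.sdiff_subset, C, hC, h2⟩)
        · exact Finset.mem_union_right _ (Finset.mem_filter.2
            ⟨Finset.mem_powerset.2 Finset.sdiff_subset, C, hC, h2⟩)
      obtain ⟨d, hd, hdD⟩ := hD _ h3
      exact (Finset.mem_sdiff.1 hd).2 hdD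
    refine X.toEntRel.weaken subset_rfl (fun g hg => ?_) ((hf M hM).2 A hA)
    obtain ⟨e, he, hge⟩ := (hf M hM).1 g hg
    exact (Finset.mem_filter.1 he).2 g
      (Finset.mem_biUnion.2 ⟨M, Finset.mem_powerset.2 (Finset.filter_subset _ _), hg⟩) hge

theorem latPrec_prox_one (X : SContEnt S) (a : X.toEntRel.Lat) (h : X.latPrec ⊤ a) : a = ⊤ := by
  revert a
  rintro ⟨V⟩ h
  refine le_antisymm le_top ?_
  obtain ⟨A', h1, h2⟩ := X.finExt_ll_iff_left.1 h ∅ (by simp)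
  have : A' = ∅ := Finset.eq_empty_of_forall_notMem fun b hb => by
    obtain ⟨c, hc, _⟩ := h1 b hb
    simp at hc
  subst this
  exact h2

theorem latPrec_prox_inf (X : SContEnt S) (a b c : X.toEntRel.Lat) (h : X.latPrec (b ⊓ c) a) :
    ∃ b' c', X.latPrec b b' ∧ X.latPrec c c' ∧ b' ⊓ c' ≤ a := by
  classical
  revert a b c
  rintro ⟨U⟩ ⟨V⟩ ⟨W⟩ h
  have h1 := X.finExt_ll_iff_left.1 h
  choose! f hf using h1
  let G : Finset S := (EntRel.finMeet V W).biUnion f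
  let p : Finset S → Finset S := fun A => G.filter fun g => ∃ a ∈ A, X.prec a g
  have hp : ∀ Z : Finset (Finset S), finExt X.ll Z (Z.image p) := fun Z =>
    X.finExt_ll_iff_left.2 fun A hA => by
      refine ⟨p A, fun g hg => (Finset.mem_filter.1 hg).2,
        X.toEntRel.finExt_of_subset fun B hB => ⟨p A, Finset.mem_image_of_mem p hA, ?_⟩⟩
      rw [Finset.mem_singleton.1 hB]
  refine ⟨Quotient.mk _ (V.image p), Quotient.mk _ (W.image p), hp V, hp W, ?_⟩
  change finExt X.rel (EntRel.finMeet _ _) U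
  intro Y hY B hB
  obtain ⟨A', hA', C', hC', rfl⟩ := Finset.mem_image₂.1 hY
  obtain ⟨A, hA, rfl⟩ := Finset.mem_image.1 hA'
  obtain ⟨C, hC, rfl⟩ := Finset.mem_image.1 hC'
  have hm : A ∪ C ∈ EntRel.finMeet V W := Finset.mem_image₂_of_mem hA hC
  refine X.toEntRel.weaken (fun g hg => ?_) subset_rfl
    ((hf _ hm).2 (f (A ∪ C)) (Finset.mem_singleton_self _) B hB)
  have hG : g ∈ G := Finset.mem_biUnion.2 ⟨_, hm, hg⟩
  obtain ⟨x, hx, hxg⟩ := (hf _ hm).1 g hg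
  rcases Finset.mem_union.1 hx with hx | hx
  · exact Finset.mem_union_left _ (Finset.mem_filter.2 ⟨hG, x, hx, hxg⟩)
  · exact Finset.mem_union_right _ (Finset.mem_filter.2 ⟨hG, x, hx, hxg⟩)

/-- The strong proximity lattice `F(X)` determined by a strong continuous entailment relation. -/
def toProxLat (X : SContEnt S) : StrongProxLat X.toEntRel.Lat where
  prec := X.latPrec
  isProximityRel := X.latPrec_isProximityRel
  idem := X.latPrec_idem
  isJoinPreservingRel := X.latPrec_isJoinPreservingRel
  prox_one := X.latPrec_prox_one
  prox_inf := X.latPrec_prox_inf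

theorem generate_cont_right (ax : Finset S → Finset S → Prop) (prec : S → S → Prop)
    (h : ∀ A B C, ax A B → PrecU prec C A → ∃ B', EntGenRel ax C B' ∧ PrecL prec B' B)
    {A B : Finset S} (hAB : EntGenRel ax A B) :
    ∀ C, PrecU prec C A → ∃ B', EntGenRel ax C B' ∧ PrecL prec B' B := by
  classical
  induction hAB with
  | ax A B hax => exact fun C hC => h A B C hax hC
  | refl a =>
    intro C hC
    obtain ⟨c, hc, hca⟩ := hC a (by simp)
    exact ⟨{c}, (EntRel.generate ax).of_mem hc (by simp), fun x hx =>
      ⟨a, by simp, by rwa [Finset.mem_singleton.1 hx]⟩⟩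
  | mono A A' B B' _ ih =>
    intro C hC
    obtain ⟨D, h1, h2⟩ := ih C fun a ha => hC a (Finset.mem_union_right _ ha)
    exact ⟨D, h1, fun d hd =>
      let ⟨b, hb, hdb⟩ := h2 d hd; ⟨b, Finset.mem_union_left _ hb, hdb⟩⟩
  | cut A B a _ _ ih1 ih2 =>
    intro C hC
    obtain ⟨D, h1, h2⟩ := ih1 C hC
    have : ∀ d, prec d a → ∃ B', EntGenRel ax ({d} ∪ C) B' ∧ PrecL prec B' B := fun d hd =>
      ih2 _ fun x hx => by
        rcases Finset.mem_union.1 hx with hx | hx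
        · exact ⟨d, by simp, by rwa [Finset.mem_singleton.1 hx]⟩
        · obtain ⟨c, hc, hcx⟩ := hC x hx
          exact ⟨c, Finset.mem_union_right _ hc, hcx⟩
    choose! f hf using this
    let D1 := D.filter fun d => prec d a
    let D2 := D.filter fun d => ¬ prec d a
    refine ⟨D2 ∪ D1.biUnion f, ?_, ?_⟩
    · refine (EntRel.generate ax).cut_right _ _ D1
        ((EntRel.generate ax).weaken subset_rfl (fun d hd => ?_) h1) fun d hd => ?_
      · by_cases hda : prec d a
        · exact Finset.mem_union_right _ (Finset.mem_filter.2 ⟨hd, hda⟩)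
        · exact Finset.mem_union_left _ (Finset.mem_union_left _
            (Finset.mem_filter.2 ⟨hd, hda⟩))
      · exact (EntRel.generate ax).weaken subset_rfl
          ((Finset.subset_biUnion_of_mem f hd).trans Finset.subset_union_right)
          (hf d (Finset.mem_filter.1 hd).2).1
    · intro x hx
      rcases Finset.mem_union.1 hx with hx | hx
      · obtain ⟨hxD, hxa⟩ := Finset.mem_filter.1 hx
        obtain ⟨b, hb, hxb⟩ := h2 x hxD
        rcases Finset.mem_union.1 hb with hb | hb
        · exact ⟨b, hb, hxb⟩
        · rw [Finset.mem_singleton.1 hb] at hxb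
          exact absurd hxb hxa
      · obtain ⟨d, hd, hxd⟩ := Finset.mem_biUnion.1 hx
        exact (hf d (Finset.mem_filter.1 hd).2).2 x hxd

theorem generate_swap {ax : Finset S → Finset S → Prop} {A B : Finset S}
    (h : EntGenRel ax A B) : EntGenRel (fun X Y => ax Y X) B A := by
  classical
  induction h with
  | ax A B h => exact EntGenRel.ax _ _ h
  | refl a => exact EntGenRel.refl a
  | mono A A' B B' _ ih =>
    rw [Finset.union_comm A', Finset.union_comm B]
    exact EntGenRel.mono _ _ _ _ ih
  | cut A B a _ _ ih1 ih2 =>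
    rw [Finset.union_comm] at ih1 ih2
    exact EntGenRel.cut _ _ a ih2 ih1

/-- The strong continuous entailment relation given by generating axioms and an idempotent
relation for which the continuity condition holds on the axioms. -/
def generate (ax : Finset S → Finset S → Prop) (prec : S → S → Prop)
    (idem : ∀ a b, (∃ c, prec a c ∧ prec c b) ↔ prec a b)
    (h : ∀ A B C, ax A B → PrecU prec C A → ∃ B', EntGenRel ax C B' ∧ PrecL prec B' B)
    (h' : ∀ A B C, ax A B → PrecL prec B C → ∃ A', PrecU prec A A' ∧ EntGenRel ax A' C) :
    SContEnt S where
  toEntRel := EntRel.generate ax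
  prec := prec
  idem := idem
  cont A B := by
    constructor
    · rintro ⟨A', h1, h2⟩
      exact generate_cont_right ax prec h h2 A h1
    · rintro ⟨B', h1, h2⟩
      obtain ⟨A', h3, h4⟩ := generate_cont_right (fun X Y => ax Y X) (fun a b => prec b a)
        (fun X Y C hax hC => by
          obtain ⟨A', h3, h4⟩ := h' Y X C hax hC
          exact ⟨A', generate_swap h4, h3⟩) (generate_swap h1) B h2
      exact ⟨A', h4, generate_swap h3⟩

end SContEnt

/-! ### The constructions `Σ`, `P_U`, `P_L` and `P_D` -/

namespace StrongProxLat

section Generated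

variable {S : Type u}

theorem gen_of_mem (ax : Finset S → Finset S → Prop) {A B : Finset S} {a : S} (h : a ∈ A)
    (h' : a ∈ B) : EntGenRel ax A B := (EntRel.generate ax).of_mem h h'

theorem gen_weaken (ax : Finset S → Finset S → Prop) {A A' B B' : Finset S} (hA : A ⊆ A')
    (hB : B ⊆ B') (h : EntGenRel ax A B) : EntGenRel ax A' B' :=
  (EntRel.generate ax).weaken hA hB h

theorem gen_trans (ax : Finset S → Finset S → Prop) {A B : Finset S} {a : S}
    (h : EntGenRel ax A {a}) (h' : EntGenRel ax {a} B) : EntGenRel ax A B := by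
  classical
  exact EntGenRel.cut A B a (gen_weaken ax subset_rfl Finset.subset_union_right h)
    (gen_weaken ax Finset.subset_union_left subset_rfl h')

end Generated

variable {S : Type u} [DistribLattice S] [BoundedOrder S]

open scoped Classical in
/-- `⊢ 0`, `a, b ⊢ a ∨ b`, and `a ⊢ b` if `b ≤ a`. -/
inductive ScottAx : Finset S → Finset S → Prop
  | bot : ScottAx ∅ {⊥}
  | sup (a b : S) : ScottAx {a, b} {a ⊔ b}
  | le (a b : S) : b ≤ a → ScottAx {a} {b}

open scoped Classical in
/-- `⊢ 1`, `a, b ⊢ a ∧ b`, and `a ⊢ b` if `a ≤ b`. -/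
inductive UpperAx : Finset S → Finset S → Prop
  | top : UpperAx ∅ {⊤}
  | inf (a b : S) : UpperAx {a, b} {a ⊓ b}
  | le (a b : S) : a ≤ b → UpperAx {a} {b}

open scoped Classical in
/-- `0 ⊢`, `a ∨ b ⊢ a, b`, and `a ⊢ b` if `a ≤ b`. -/
inductive LowerAx : Finset S → Finset S → Prop
  | bot : LowerAx {⊥} ∅
  | sup (a b : S) : LowerAx {a ⊔ b} {a, b}
  | le (a b : S) : a ≤ b → LowerAx {a} {b}

/-- `a ⊢ b` if `a ≤ b`. -/
inductive DoubleAx : Finset S → Finset S → Prop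
  | le (a b : S) : a ≤ b → DoubleAx {a} {b}

variable (P : StrongProxLat S)

theorem prec_sup {a a' b b' : S} (h : P.prec a a') (h' : P.prec b b') :
    P.prec (a ⊔ b) (a' ⊔ b') :=
  P.isProximityRel.sup_left _ _ _ (P.isProximityRel.up _ _ _ le_sup_left h)
    (P.isProximityRel.up _ _ _ le_sup_right h')

theorem prec_inf {a a' b b' : S} (h : P.prec a a') (h' : P.prec b b') :
    P.prec (a ⊓ b) (a' ⊓ b') :=
  P.isProximityRel.inf_right _ _ _ (P.isProximityRel.down _ _ _ inf_le_left h)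
    (P.isProximityRel.down _ _ _ inf_le_right h')

/-- `Σ(S) = (S, ⊢_Σ, ≻)`. -/
def scott : SContEnt S :=
  SContEnt.generate ScottAx (fun a b => P.prec b a)
    (fun a b => by
      rw [← P.idem]
      exact exists_congr fun c => and_comm)
    (by
      classical
      rintro _ _ C (_ | ⟨a, b⟩ | ⟨a, b, hba⟩) hC
      · exact ⟨{⊥}, gen_weaken _ (Finset.empty_subset _) subset_rfl
          (EntGenRel.ax _ _ ScottAx.bot), by
          simpa [PrecL] using P.isProximityRel.bot_left ⊥⟩
      · obtain ⟨c, hc, hca⟩ := hC a (by simp)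
        obtain ⟨d, hd, hdb⟩ := hC b (by simp)
        refine ⟨{c ⊔ d}, gen_weaken _ ?_ subset_rfl (EntGenRel.ax _ _ (ScottAx.sup c d)), by
          simpa [PrecL] using P.prec_sup hca hdb⟩
        simp [Finset.insert_subset_iff, hc, hd]
      · obtain ⟨c, hc, hca⟩ := hC a (by simp)
        exact ⟨{c}, gen_of_mem _ hc (by simp), by
          simpa [PrecL] using P.isProximityRel.down _ _ _ hba hca⟩)
    (by
      classical
      rintro _ _ C (_ | ⟨a, b⟩ | ⟨a, b, hba⟩) hC
      · obtain ⟨c, hc, hc0⟩ := hC ⊥ (by simp)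
        have := P.isJoinPreservingRel.prox_zero _ hc0
        subst this
        exact ⟨∅, by simp [PrecU], gen_weaken _ subset_rfl (by simpa using hc)
          (EntGenRel.ax _ _ ScottAx.bot)⟩
      · obtain ⟨c, hc, hcab⟩ := hC (a ⊔ b) (by simp)
        obtain ⟨a', b', h1, h2, h3⟩ := P.isJoinPreservingRel.prox_sup _ _ _ hcab
        refine ⟨{a', b'}, by simp [PrecU, h2, h3], ?_⟩
        exact gen_trans _ (EntGenRel.ax _ _ (ScottAx.sup a' b'))
          (gen_weaken _ subset_rfl (by simpa using hc) (EntGenRel.ax _ _ (ScottAx.le _ c h1)))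
      · obtain ⟨c, hc, hcb⟩ := hC b (by simp)
        exact ⟨{c}, by simpa [PrecU] using P.isProximityRel.up _ _ _ hba hcb,
          gen_of_mem _ (by simp) hc⟩)

/-- The upper powerlocale `P_U(S) = (S, ⊢_U, ≺)`. -/
def upper : SContEnt S :=
  SContEnt.generate UpperAx P.prec P.idem
    (by
      classical
      rintro _ _ C (_ | ⟨a, b⟩ | ⟨a, b, hab⟩) hC
      · exact ⟨{⊤}, gen_weaken _ (Finset.empty_subset _) subset_rfl
          (EntGenRel.ax _ _ UpperAx.top), by
          simpa [PrecL] using P.isProximityRel.top_right ⊤⟩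
      · obtain ⟨c, hc, hca⟩ := hC a (by simp)
        obtain ⟨d, hd, hdb⟩ := hC b (by simp)
        refine ⟨{c ⊓ d}, gen_weaken _ ?_ subset_rfl (EntGenRel.ax _ _ (UpperAx.inf c d)), by
          simpa [PrecL] using P.prec_inf hca hdb⟩
        simp [Finset.insert_subset_iff, hc, hd]
      · obtain ⟨c, hc, hca⟩ := hC a (by simp)
        exact ⟨{c}, gen_of_mem _ hc (by simp), by
          simpa [PrecL] using P.isProximityRel.up _ _ _ hab hca⟩)
    (by
      classical
      rintro _ _ C (_ | ⟨a, b⟩ | ⟨a, b, hab⟩) hC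
      · obtain ⟨c, hc, hc0⟩ := hC ⊤ (by simp)
        have := P.prox_one _ hc0
        subst this
        exact ⟨∅, by simp [PrecU], gen_weaken _ subset_rfl (by simpa using hc)
          (EntGenRel.ax _ _ UpperAx.top)⟩
      · obtain ⟨c, hc, hcab⟩ := hC (a ⊓ b) (by simp)
        obtain ⟨a', b', h1, h2, h3⟩ := P.prox_inf _ _ _ hcab
        refine ⟨{a', b'}, by simp [PrecU, h1, h2], ?_⟩
        exact gen_trans _ (EntGenRel.ax _ _ (UpperAx.inf a' b'))
          (gen_weaken _ subset_rfl (by simpa using hc) (EntGenRel.ax _ _ (UpperAx.le _ c h3)))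
      · obtain ⟨c, hc, hbc⟩ := hC b (by simp)
        exact ⟨{c}, by simpa [PrecU] using P.isProximityRel.down _ _ _ hab hbc,
          gen_of_mem _ (by simp) hc⟩)

/-- The lower powerlocale `P_L(S) = (S, ⊢_L, ≺)`. -/
def lower : SContEnt S :=
  SContEnt.generate LowerAx P.prec P.idem
    (by
      classical
      rintro _ _ C (_ | ⟨a, b⟩ | ⟨a, b, hab⟩) hC
      · obtain ⟨c, hc, hc0⟩ := hC ⊥ (by simp)
        have := P.isJoinPreservingRel.prox_zero _ hc0
        subst this
        exact ⟨∅, gen_weaken _ (by simpa using hc) subset_rfl (EntGenRel.ax _ _ LowerAx.bot),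
          by simp [PrecL]⟩
      · obtain ⟨c, hc, hcab⟩ := hC (a ⊔ b) (by simp)
        obtain ⟨a', b', h1, h2, h3⟩ := P.isJoinPreservingRel.prox_sup _ _ _ hcab
        refine ⟨{a', b'}, ?_, by simp [PrecL, h2, h3]⟩
        exact gen_trans _
          (gen_weaken _ (by simpa using hc) subset_rfl (EntGenRel.ax _ _ (LowerAx.le c _ h1)))
          (EntGenRel.ax _ _ (LowerAx.sup a' b'))
      · obtain ⟨c, hc, hca⟩ := hC a (by simp)
        exact ⟨{c}, gen_of_mem _ hc (by simp), by
          simpa [PrecL] using P.isProximityRel.up _ _ _ hab hca⟩)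
    (by
      classical
      rintro _ _ C (_ | ⟨a, b⟩ | ⟨a, b, hab⟩) hC
      · exact ⟨{⊥}, by simpa [PrecU] using P.isProximityRel.bot_left ⊥,
          gen_weaken _ subset_rfl (Finset.empty_subset _) (EntGenRel.ax _ _ LowerAx.bot)⟩
      · obtain ⟨c, hc, hac⟩ := hC a (by simp)
        obtain ⟨d, hd, hbd⟩ := hC b (by simp)
        refine ⟨{c ⊔ d}, by simpa [PrecU] using P.prec_sup hac hbd,
          gen_weaken _ subset_rfl ?_ (EntGenRel.ax _ _ (LowerAx.sup c d))⟩
        simp [Finset.insert_subset_iff, hc, hd]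
      · obtain ⟨c, hc, hbc⟩ := hC b (by simp)
        exact ⟨{c}, by simpa [PrecU] using P.isProximityRel.down _ _ _ hab hbc,
          gen_of_mem _ (by simp) hc⟩)

/-- The double powerlocale `P_D(S) = (S, ⊢_D, ≺)`. -/
def double : SContEnt S :=
  SContEnt.generate DoubleAx P.prec P.idem
    (by
      rintro _ _ C ⟨a, b, hab⟩ hC
      obtain ⟨c, hc, hca⟩ := hC a (by simp)
      exact ⟨{c}, gen_of_mem _ hc (by simp), by
        simpa [PrecL] using P.isProximityRel.up _ _ _ hab hca⟩)
    (by
      rintro _ _ C ⟨a, b, hab⟩ hC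
      obtain ⟨c, hc, hbc⟩ := hC b (by simp)
      exact ⟨{c}, by simpa [PrecU] using P.isProximityRel.down _ _ _ hab hbc,
        gen_of_mem _ (by simp) hc⟩)

end StrongProxLat

/-! All four isomorphisms come from duality and one computation, `P_L(P_U(S)) ≅ P_D(S)`. Since `Sᵒᵈ`
has the same elements as `S`, comparing axioms gives literal equalities: `Σ(S) = P_U(Sᵈ)`, `Σ(S) =
P_L(S)ᵈ` and `P_D(S)ᵈ = P_D(Sᵈ)`. Hence `P_L(Σ(S)) = P_L(P_U(Sᵈ)) ≅ P_D(Sᵈ)`, `Σ(P_U(S)) =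
P_L(P_U(S))ᵈ ≅ P_D(S)ᵈ = P_D(Sᵈ)`, and, by the latter for `Sᵈ`, `Σ(Σ(S)) ≅ P_D(S)`.

Isomorphisms are found by presenting one lattice twice (`Presents`). If `f` and `g` are generators
of a strong proximity lattice for `X` and `Y`, the relation `⋀ f(A) ≺ ⋁ g(B)` and its converse
counterpart are mutually inverse maps. Cut composition is then interpolation for `≺`, because every
lattice element is a join of meets of generators (`cutComp_prec`). The relation "`X` presents
`F(Y)`" (`StrictEquiv`) is an equivalence compatible with duals.

For the computation, the generated entailments are made explicit: `A ⊢_D B` iff some `a ≤ b`; `A ⊢_U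
B` iff `⋀ A ≤ b` for some `b`; `A ⊢_L B` iff `a ≤ ⋁ B` for some `a`. Between generators `η a` of
`F(P_U(S))`, entailment in `P_L` therefore says that some `η a ≤ ⋁ η b`, that is `{a} ⊢_U B`, that
is `a ≤ b` for some `b`: this is `⊢_D`. The `η a` suffice as generators because each element of
`F(P_U(S))` is a join of them and `P_L` turns such joins into joins. -/

/-! ### Evaluation of finite sets of finite sets, and finite forms of the proximity axioms. -/

section Evaluation

variable {S : Type u} {L : Type v} [DistribLattice L] [BoundedOrder L]

/-- The join of meets `⋁_{A ∈ 𝒰} ⋀_{a ∈ A} f a`. -/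
def finEval (f : S → L) (U : Finset (Finset S)) : L := U.sup fun A => A.inf f

/-- Distributivity rewrites a join of meets as a meet of joins, and `finStar` indexes the latter. It
explains the definition of `finExt` and makes presentations self-dual. -/
theorem finEval_eq_inf_finStar (f : S → L) (U : Finset (Finset S)) :
    finEval f U = (finStar U).inf fun B => B.sup f := by
  classical
  induction U using Finset.induction_on with
  | empty => simp [finEval, finStar_empty]
  | insert A U _ ih =>
    have h : finEval f (insert A U) = A.inf f ⊔ finEval f U := by
      simp [finEval]
    rw [h]
    apply le_antisymm
    · refine Finset.le_inf fun D hD => ?_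
      obtain ⟨B, hB, C, hCA, ⟨c, hc⟩, rfl⟩ := (mem_finStar_insert U A D).1 hD
      rw [Finset.sup_union, sup_comm]
      refine sup_le_sup ?_ ((Finset.inf_le (hCA hc)).trans (Finset.le_sup hc))
      rw [ih]
      exact Finset.inf_le hB
    · rw [ih, Finset.inf_sup_distrib_right]
      refine Finset.le_inf fun a ha => ?_
      rw [Finset.inf_sup_distrib_left]
      refine Finset.le_inf fun B hB => ?_
      refine (Finset.inf_le ((mem_finStar_insert U A (B ∪ {a})).2
        ⟨B, hB, {a}, by simpa using ha, by simp, rfl⟩)).trans ?_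
      rw [Finset.sup_union, Finset.sup_singleton, sup_comm]

/-- With its companion for meets, this shows that the values of `finEval f` form a sublattice, so
surjectivity need only be checked on generators. -/
theorem exists_finEval_sup {ι : Type*} {f : S → L} {x : ι → L} (I : Finset ι)
    (h : ∀ i ∈ I, ∃ U, finEval f U = x i) : ∃ U, finEval f U = I.sup x := by
  classical
  refine Finset.sup_induction (p := fun l => ∃ U, finEval f U = l) ⟨∅, rfl⟩ ?_ h
  rintro _ ⟨U, rfl⟩ _ ⟨V, rfl⟩
  exact ⟨U ∪ V, Finset.sup_union⟩

theorem exists_finEval_inf {ι : Type*} {f : S → L} {x : ι → L} (I : Finset ι)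
    (h : ∀ i ∈ I, ∃ U, finEval f U = x i) : ∃ U, finEval f U = I.inf x := by
  classical
  refine Finset.inf_induction (p := fun l => ∃ U, finEval f U = l)
    ⟨{∅}, by simp [finEval]⟩ ?_ h
  rintro _ ⟨U, rfl⟩ _ ⟨V, rfl⟩
  rw [finEval, finEval, Finset.sup_inf_sup]
  refine exists_finEval_sup _ fun A _ => ⟨{A.1 ∪ A.2}, ?_⟩
  rw [finEval, Finset.sup_singleton, Finset.inf_union]

theorem IsProximityRel.finset_inf {T : Type w} [DistribLattice T] [BoundedOrder T]
    {r : T → L → Prop} (hr : IsProximityRel r) {a : T} {I : Finset S} {g : S → L}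
    (h : ∀ i ∈ I, r a (g i)) : r a (I.inf g) := by
  classical
  induction I using Finset.induction_on with
  | empty => exact hr.top_right a
  | insert i I _ ih =>
    rw [Finset.inf_insert]
    exact hr.inf_right _ _ _ (h i (by simp)) (ih fun j hj => h j (Finset.mem_insert_of_mem hj))

theorem IsProximityRel.finset_sup {T : Type w} [DistribLattice T] [BoundedOrder T]
    {r : L → T → Prop} (hr : IsProximityRel r) {b : T} {I : Finset S} {g : S → L}
    (h : ∀ i ∈ I, r (g i) b) : r (I.sup g) b := by
  classical
  induction I using Finset.induction_on with
  | empty => exact hr.bot_left b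
  | insert i I _ ih =>
    rw [Finset.sup_insert]
    exact hr.sup_left _ _ _ (h i (by simp)) (ih fun j hj => h j (Finset.mem_insert_of_mem hj))

theorem IsJoinPreservingRel.exists_le_finset_sup {r : L → L → Prop} (hj : IsJoinPreservingRel r)
    {a : L} {I : Finset S} {g : S → L} (h : r a (I.sup g)) :
    ∃ c : S → L, a ≤ I.sup c ∧ ∀ i ∈ I, r (c i) (g i) := by
  classical
  induction I using Finset.induction_on generalizing a with
  -- The empty join is `⊥`, so `prox_zero` forces `a = ⊥`; `g` is an arbitrary default.
  | empty => exact ⟨g, (hj.prox_zero a h).le, by simp⟩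
  | insert i I hi ih =>
    rw [Finset.sup_insert] at h
    obtain ⟨b, c, h1, h2, h3⟩ := hj.prox_sup _ _ _ h
    obtain ⟨d, h4, h5⟩ := ih h3
    have hne : ∀ j ∈ I, j ≠ i := fun j hj hji => hi (hji ▸ hj)
    refine ⟨Function.update d i b, ?_, fun j hj => ?_⟩
    · have h6 : I.sup (Function.update d i b) = I.sup d :=
        Finset.sup_congr rfl fun j hj => Function.update_of_ne (hne j hj) _ _
      rw [Finset.sup_insert, Function.update_self, h6]
      exact h1.trans (sup_le_sup le_rfl h4)
    · rcases Finset.mem_insert.1 hj with rfl | hj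
      · rwa [Function.update_self]
      · rw [Function.update_of_ne (hne j hj)]
        exact h5 j hj

end Evaluation

/-! ### Presentations -/

/-- `f` exhibits the strong proximity lattice `P` as the one presented by `X`. -/
structure SContEnt.Presents {S : Type u} {L : Type v} [DistribLattice L] [BoundedOrder L]
    (X : SContEnt S) (P : StrongProxLat L) (f : S → L) : Prop where
  rel_iff : ∀ A B, X.rel A B ↔ A.inf f ≤ B.sup f
  ll_iff : ∀ A B, X.ll A B ↔ P.prec (A.inf f) (B.sup f)
  exists_finEval : ∀ l, ∃ U, finEval f U = l

namespace SContEnt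

variable {S : Type u} {T : Type v} {X : SContEnt S} {Y : SContEnt T}

/-- Dualising turns `≺_U` followed by `⊢` into `⊢` followed by `≺_L`, which is the same relation by
continuity. -/
theorem dual_ll (X : SContEnt S) (A B : Finset S) : X.dual.ll A B ↔ X.ll B A := by
  refine Iff.trans ?_ (X.cont B A).symm
  exact exists_congr fun C => and_comm

namespace Presents

variable {R : Type*} {L : Type*} [DistribLattice L] [BoundedOrder L] {P : StrongProxLat L}
  {f : S → L} {g : T → L}

/-- With the left side read as a join of meets and the right side as a meet of joins, the inequality
splits into the entailments that define `finExt`. -/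
theorem finExt_rel_iff (h : X.Presents P f) (U V : Finset (Finset S)) :
    finExt X.rel U V ↔ finEval f U ≤ finEval f V := by
  rw [finEval_eq_inf_finStar f V, finEval, Finset.sup_le_iff]
  refine forall₂_congr fun A _ => ?_
  rw [Finset.le_inf_iff]
  exact forall₂_congr fun B _ => h.rel_iff A B

theorem finExt_ll_iff (h : X.Presents P f) (U V : Finset (Finset S)) :
    finExt X.ll U V ↔ P.prec (finEval f U) (finEval f V) := by
  rw [finEval_eq_inf_finStar f V]
  constructor
  · exact fun H => P.isProximityRel.finset_sup fun A hA =>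
      P.isProximityRel.finset_inf fun B hB => (h.ll_iff A B).1 (H A hA B hB)
  · exact fun H A hA B hB => (h.ll_iff A B).2 (P.isProximityRel.up _ _ _
      (Finset.inf_le (f := fun B => B.sup f) hB)
      (P.isProximityRel.down _ _ _ (Finset.le_sup (f := fun A => A.inf f) hA) H))

/-- A lattice presented by `X` is isomorphic to `F(X)`. -/
theorem exists_orderIso (h : X.Presents P f) :
    ∃ e : X.toEntRel.Lat ≃o L, ∀ a b, X.latPrec a b ↔ P.prec (e a) (e b) := by
  let φ : X.toEntRel.Lat → L := Quotient.lift (finEval f) fun U V hUV =>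
    le_antisymm ((h.finExt_rel_iff U V).1 hUV.1) ((h.finExt_rel_iff V U).1 hUV.2)
  have hle : ∀ a b, φ a ≤ φ b ↔ a ≤ b := by
    rintro ⟨U⟩ ⟨V⟩
    exact (h.finExt_rel_iff U V).symm
  have hbij : Function.Bijective φ := by
    refine ⟨fun a b hab => le_antisymm ((hle a b).1 hab.le) ((hle b a).1 hab.ge), fun l => ?_⟩
    obtain ⟨U, hU⟩ := h.exists_finEval l
    exact ⟨Quotient.mk _ U, hU⟩
  refine ⟨⟨Equiv.ofBijective φ hbij, hle _ _⟩, ?_⟩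
  rintro ⟨U⟩ ⟨V⟩
  exact h.finExt_ll_iff U V

theorem map {M : Type*} [DistribLattice M] [BoundedOrder M] {Q : StrongProxLat M}
    (h : X.Presents P f) (e : L ≃o M) (he : ∀ a b, P.prec a b ↔ Q.prec (e a) (e b)) :
    X.Presents Q (e ∘ f) where
  rel_iff A B := by
    rw [h.rel_iff, ← map_finset_inf, ← map_finset_sup, e.le_iff_le]
  ll_iff A B := by
    rw [h.ll_iff, ← map_finset_inf, ← map_finset_sup, he]
  exists_finEval m := by
    obtain ⟨U, hU⟩ := h.exists_finEval (e.symm m)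
    refine ⟨U, ?_⟩
    rw [← e.apply_symm_apply m, ← hU, finEval, finEval, map_finset_sup]
    exact Finset.sup_congr rfl fun A _ => (map_finset_inf e A f).symm

theorem dual (h : X.Presents P f) : X.dual.Presents P.dual (OrderDual.toDual ∘ f) where
  rel_iff A B := h.rel_iff B A
  ll_iff A B := (dual_ll X A B).trans (h.ll_iff B A)
  exists_finEval l := by
    obtain ⟨U, hU⟩ := h.exists_finEval (OrderDual.ofDual l)
    -- A join of meets in the opposite lattice is a meet of joins in `L`, so `finStar U` names the
    -- element that `U` names in `L`.
    exact ⟨finStar U, (finEval_eq_inf_finStar f U).symm.trans hU⟩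

/-- A cut family `V` amounts to an interpolant, its value `finEval g V`; conversely every
interpolant given by idempotence of `≺` is such a value. Only the middle generators need to present
`P`. -/
theorem cutComp_prec (h : Y.Presents P g) (f : S → L) (k : R → L) :
    cutComp (fun B C => P.prec (B.inf g) (C.sup k)) (fun A B => P.prec (A.inf f) (B.sup g)) =
      fun A C => P.prec (A.inf f) (C.sup k) := by
  ext A C
  rw [← P.idem]
  constructor
  · rintro ⟨V, h1, h2⟩
    refine ⟨finEval g V, ?_, P.isProximityRel.finset_sup h2⟩
    rw [finEval_eq_inf_finStar]
    exact P.isProximityRel.finset_inf h1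
  · rintro ⟨l, h1, h2⟩
    obtain ⟨V, rfl⟩ := h.exists_finEval l
    refine ⟨V, fun B hB => ?_, fun B hB => ?_⟩
    · rw [finEval_eq_inf_finStar] at h1
      exact P.isProximityRel.up _ _ _ (Finset.inf_le (f := fun B => B.sup g) hB) h1
    · exact P.isProximityRel.down _ _ _ (Finset.le_sup (f := fun A => A.inf g) hB) h2

theorem ll_eq (h : X.Presents P f) : X.ll = fun A B => P.prec (A.inf f) (B.sup f) := by
  ext A B
  exact h.ll_iff A B

/-- The identity laws are instances of `cutComp_prec`. Join preservation reflects the finite form of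
`prox_sup`. -/
theorem isJoinPresProxMap (h : X.Presents P f) (h' : Y.Presents P g) :
    IsJoinPresProxMap X Y fun A B => P.prec (A.inf f) (B.sup g) where
  upper A A' B B' H := by
    classical
    exact P.isProximityRel.up _ _ _ (Finset.sup_mono Finset.subset_union_left)
      (P.isProximityRel.down _ _ _ (Finset.inf_mono Finset.subset_union_left) H)
  ll_comp := by
    rw [h'.ll_eq, h'.cutComp_prec]
  comp_ll := by
    rw [h.ll_eq, h.cutComp_prec]
  join_pres A B H := by
    classical
    obtain ⟨c, h1, h2⟩ := P.isJoinPreservingRel.exists_le_finset_sup H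
    choose W hW using fun b => h.exists_finEval (c b)
    -- Each approximant `c b` is a join of meets indexed by `W b`; pooling these families over `B`
    -- covers the meet of `A`, and each member lies below one `c b ≺ g b`.
    refine ⟨B.biUnion W, ?_, fun A' hA' => ?_⟩
    · rw [h.finExt_rel_iff, finEval, Finset.sup_singleton]
      refine h1.trans (Finset.sup_le fun b hb => ?_)
      rw [← hW b]
      exact Finset.sup_mono (Finset.subset_biUnion_of_mem W hb)
    · obtain ⟨b, hb, hA'⟩ := Finset.mem_biUnion.1 hA'
      refine ⟨b, hb, ?_⟩
      rw [Finset.sup_singleton]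
      refine P.isProximityRel.down _ _ _ ?_ (h2 b hb)
      rw [← hW b]
      exact Finset.le_sup (f := fun A => A.inf f) hA'

theorem isomorphic (h : X.Presents P f) (h' : Y.Presents P g) : Isomorphic X Y :=
  ⟨_, _, h.isJoinPresProxMap h', h'.isJoinPresProxMap h,
    (h'.cutComp_prec f f).trans h.ll_eq.symm, (h.cutComp_prec g g).trans h'.ll_eq.symm⟩

end Presents

/-! ### The tautological presentation of `F(X)` by `X`. -/

/-- The element of `F(X)` represented by a finite set of finite sets. -/
def latMk (X : SContEnt S) (U : Finset (Finset S)) : X.toEntRel.Lat := Quotient.mk _ U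

/-- The generators of `F(X)`. -/
def latGen (X : SContEnt S) (a : S) : X.toEntRel.Lat := X.latMk {{a}}

theorem inf_latGen (X : SContEnt S) (A : Finset S) : A.inf X.latGen = X.latMk {A} := by
  classical
  induction A using Finset.induction_on with
  | empty => rfl
  | insert a A _ ih =>
    rw [Finset.inf_insert, ih]
    change X.latMk (EntRel.finMeet {{a}} {A}) = _
    rw [EntRel.finMeet, Finset.image₂_singleton]
    rfl

open scoped Classical in
theorem sup_latMk (X : SContEnt S) {ι : Type*} (I : Finset ι) (F : ι → Finset S) :
    (I.sup fun i => X.latMk {F i}) = X.latMk (I.image F) := by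
  induction I using Finset.induction_on with
  | empty => rfl
  | insert i I _ ih =>
    rw [Finset.sup_insert, ih, Finset.image_insert]
    rfl

-- A family of singletons admits only one selection, so `finStar` of the singletons of `B` is `{B}`.
open scoped Classical in
theorem finExt_singleton_image {r : Finset S → Finset T → Prop}
    (A : Finset S) (B : Finset T) :
    finExt r {A} (B.image singleton) ↔ r A B := by
  have : finStar (B.image singleton) = {B} := by
    ext C
    simp only [finStar, Finset.mem_filter, Finset.mem_powerset, Finset.mem_singleton,
      Finset.mem_image, forall_exists_index, and_imp, forall_apply_eq_imp_iff₂]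
    have h1 : ∀ b : T, ({b} ∩ C).Nonempty ↔ b ∈ C := fun b => by
      simp [Finset.Nonempty]
    have h2 : (Finset.image singleton B).biUnion id = B := by
      ext b; simp
    simp only [h1]
    rw [h2]
    exact ⟨fun h => h.1.antisymm h.2, fun h => h ▸ ⟨subset_rfl, fun b hb => hb⟩⟩
  simp [finExt, this]

theorem presents_toProxLat (X : SContEnt S) : X.Presents X.toProxLat X.latGen where
  rel_iff A B := by
    rw [inf_latGen, show B.sup X.latGen = _ from X.sup_latMk B singleton]
    exact (finExt_singleton_image A B).symm
  ll_iff A B := by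
    rw [inf_latGen, show B.sup X.latGen = _ from X.sup_latMk B singleton]
    exact (finExt_singleton_image A B).symm
  exists_finEval := by
    rintro ⟨U⟩
    refine ⟨U, ?_⟩
    simp only [finEval, inf_latGen]
    classical
    exact (X.sup_latMk U id).trans (by rw [Finset.image_id]; rfl)

/-! ### Entailment relations with isomorphic lattices. -/

/-- `F(X)` and `F(Y)` are isomorphic as lattices with a proximity relation. -/
def StrictEquiv (X : SContEnt S) (Y : SContEnt T) : Prop := ∃ f, X.Presents Y.toProxLat f

namespace StrictEquiv

/-- A presentation of `F(Y)` by `X` yields an isomorphism `F(X) ≅ F(Y)`, along whose inverse the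
tautological presentation by `Y` is transported. -/
theorem symm (h : StrictEquiv X Y) : StrictEquiv Y X := by
  obtain ⟨f, hf⟩ := h
  obtain ⟨e, he⟩ := hf.exists_orderIso
  exact ⟨_, Y.presents_toProxLat.map (Q := X.toProxLat) e.symm fun a b => by
    refine Iff.trans ?_ (he _ _).symm
    simp⟩

theorem trans {R : Type*} {Z : SContEnt R} (h : StrictEquiv X Y) (h' : StrictEquiv Y Z) :
    StrictEquiv X Z := by
  obtain ⟨f, hf⟩ := h
  obtain ⟨g, hg⟩ := h'
  obtain ⟨e, he⟩ := hg.exists_orderIso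
  exact ⟨_, hf.map e he⟩

/-- `X.dual` presents the dual of `F(Y)`, which is identified with `F(Y.dual)` because `Y.dual`
presents it too. -/
theorem dual (h : StrictEquiv X Y) : StrictEquiv X.dual Y.dual := by
  obtain ⟨f, hf⟩ := h
  obtain ⟨e, he⟩ := Y.presents_toProxLat.dual.exists_orderIso
  exact ⟨_, hf.dual.map (Q := Y.dual.toProxLat) e.symm fun a b => by
    refine Iff.trans ?_ (he _ _).symm
    simp⟩

theorem isomorphic (h : StrictEquiv X Y) : Isomorphic X Y := by
  obtain ⟨f, hf⟩ := h
  exact hf.isomorphic Y.presents_toProxLat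

end StrictEquiv

theorem strictEquiv_refl (X : SContEnt S) : StrictEquiv X X := ⟨_, X.presents_toProxLat⟩

theorem eq_of_rel_prec {X Y : SContEnt S} (h : X.rel = Y.rel) (h' : X.prec = Y.prec) :
    X = Y := by
  rcases X with ⟨⟨_, _, _, _⟩, _, _, _⟩
  rcases Y with ⟨⟨_, _, _, _⟩, _, _, _⟩
  cases h
  cases h'
  rfl

end SContEnt

/-! ### Duality equalities among the four constructions. -/

theorem EntGenRel.imp {S : Type u} {ax ax' : Finset S → Finset S → Prop}
    (h : ∀ A B, ax A B → ax' A B) {A B : Finset S} (hAB : EntGenRel ax A B) :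
    EntGenRel ax' A B := by
  classical
  induction hAB with
  | ax A B hax => exact EntGenRel.ax _ _ (h A B hax)
  | refl a => exact EntGenRel.refl a
  | mono A A' B B' _ ih => exact EntGenRel.mono _ _ _ _ ih
  | cut A B a _ _ ih1 ih2 => exact EntGenRel.cut _ _ a ih1 ih2

namespace StrongProxLat

variable {S : Type u} [DistribLattice S] [BoundedOrder S] (P : StrongProxLat S)

theorem upperAx_toDual_iff (A B : Finset S) :
    @UpperAx Sᵒᵈ _ _ A B ↔ ScottAx A B := by
  constructor
  · rintro (_ | ⟨a, b⟩ | ⟨a, b, h⟩)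
    · exact ScottAx.bot
    · exact ScottAx.sup (S := S) a b
    · exact ScottAx.le (S := S) a b h
  · rintro (_ | ⟨a, b⟩ | ⟨a, b, h⟩)
    · exact @UpperAx.top Sᵒᵈ _ _
    · exact @UpperAx.inf Sᵒᵈ _ _ a b
    · exact @UpperAx.le Sᵒᵈ _ _ a b h

theorem scottAx_iff_lowerAx (A B : Finset S) : ScottAx A B ↔ LowerAx B A := by
  constructor
  · rintro (_ | ⟨a, b⟩ | ⟨a, b, h⟩)
    · exact LowerAx.bot
    · exact LowerAx.sup a b
    · exact LowerAx.le _ _ h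
  · rintro (_ | ⟨a, b⟩ | ⟨a, b, h⟩)
    · exact ScottAx.bot
    · exact ScottAx.sup a b
    · exact ScottAx.le _ _ h

theorem doubleAx_toDual_iff {S : Type u} [DistribLattice S] (A B : Finset S) :
    @DoubleAx Sᵒᵈ _ A B ↔ DoubleAx B A := by
  constructor
  · rintro ⟨a, b, h⟩
    exact DoubleAx.le (S := S) b a h
  · rintro ⟨a, b, h⟩
    exact @DoubleAx.le Sᵒᵈ _ b a h

/-- The type ascription uses that `Sᵒᵈ` unfolds to `S`, so this is an equality, not merely an
isomorphism. -/
theorem scott_eq_dual_upper : P.scott = (@upper Sᵒᵈ _ _ P.dual : SContEnt S) := by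
  refine SContEnt.eq_of_rel_prec ?_ rfl
  ext A B
  exact ⟨EntGenRel.imp fun A B => (upperAx_toDual_iff (S := S) A B).2,
    EntGenRel.imp fun A B => (upperAx_toDual_iff (S := S) A B).1⟩

theorem scott_eq_lower_dual : P.scott = P.lower.dual := by
  refine SContEnt.eq_of_rel_prec ?_ rfl
  ext A B
  exact ⟨fun h => (SContEnt.generate_swap h).imp fun A B => (scottAx_iff_lowerAx B A).1,
    fun h => (SContEnt.generate_swap h).imp fun A B => (scottAx_iff_lowerAx A B).2⟩

theorem double_dual_eq : P.double.dual = (@double Sᵒᵈ _ _ P.dual : SContEnt S) := by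
  refine SContEnt.eq_of_rel_prec ?_ rfl
  ext A B
  exact ⟨fun h => (SContEnt.generate_swap h).imp fun A B => (doubleAx_toDual_iff (S := S) A B).2,
    fun h => (SContEnt.generate_swap h).imp fun A B => (doubleAx_toDual_iff (S := S) B A).1⟩

/-! ### Explicit descriptions of the generated entailments and of `≪`. -/

theorem double_rel_iff (A B : Finset S) :
    P.double.rel A B ↔ ∃ a ∈ A, ∃ b ∈ B, a ≤ b := by
  classical
  constructor
  · intro h
    change EntGenRel DoubleAx A B at h
    induction h with
    | ax A B h =>
      obtain ⟨a, b, h⟩ := h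
      exact ⟨a, by simp, b, by simp, h⟩
    | refl a => exact ⟨a, by simp, a, by simp, le_rfl⟩
    | mono A A' B B' _ ih =>
      obtain ⟨a, ha, b, hb, h⟩ := ih
      exact ⟨a, Finset.mem_union_right _ ha, b, Finset.mem_union_left _ hb, h⟩
    | cut A B c _ _ ih1 ih2 =>
      obtain ⟨a, ha, b, hb, h⟩ := ih1
      obtain ⟨a', ha', b', hb', h'⟩ := ih2
      simp only [Finset.mem_union, Finset.mem_singleton] at hb ha'
      rcases hb with hb | rfl
      · exact ⟨a, ha, b, hb, h⟩
      -- When both premises use the cut element, transitivity of `≤` joins them; otherwise the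
      -- second premise alone suffices.
      · rcases ha' with rfl | ha'
        · exact ⟨a, ha, b', hb', h.trans h'⟩
        · exact ⟨a', ha', b', hb', h'⟩
  · rintro ⟨a, ha, b, hb, h⟩
    exact gen_weaken _ (Finset.singleton_subset_iff.2 ha) (Finset.singleton_subset_iff.2 hb)
      (EntGenRel.ax _ _ (DoubleAx.le a b h))

theorem upper_rel_iff (A B : Finset S) :
    P.upper.rel A B ↔ ∃ b ∈ B, A.inf id ≤ b := by
  classical
  constructor
  · intro h
    change EntGenRel UpperAx A B at h
    induction h with
    | ax A B h =>
      rcases h with _ | ⟨a, b⟩ | ⟨a, b, h⟩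
      · exact ⟨⊤, by simp, by simp⟩
      · exact ⟨a ⊓ b, by simp, by simp⟩
      · exact ⟨b, by simp, by simpa using h⟩
    | refl a => exact ⟨a, by simp, by simp⟩
    | mono A A' B B' _ ih =>
      obtain ⟨b, hb, h⟩ := ih
      exact ⟨b, Finset.mem_union_left _ hb,
        (Finset.inf_mono Finset.subset_union_right).trans h⟩
    | cut A B c _ _ ih1 ih2 =>
      obtain ⟨b, hb, h⟩ := ih1
      obtain ⟨b', hb', h'⟩ := ih2
      simp only [Finset.mem_union, Finset.mem_singleton] at hb
      rcases hb with hb | rfl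
      · exact ⟨b, hb, h⟩
      · refine ⟨b', hb', le_trans ?_ h'⟩
        -- The cut element lies above the meet of `A`, so adjoining it to `A` leaves the meet
        -- unchanged.
        rw [Finset.inf_union, Finset.inf_singleton]
        exact le_inf h le_rfl
  · rintro ⟨b, hb, h⟩
    -- The axioms for `⊤` and binary meets derive the finite meet of `A`; weakening along `≤` then
    -- reaches `b`.
    have key : EntGenRel UpperAx A {A.inf id} := by
      clear h
      induction A using Finset.induction_on with
      | empty => exact EntGenRel.ax _ _ UpperAx.top
      | insert a A _ ih =>
        rw [Finset.inf_insert]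
        let E := EntRel.generate (UpperAx (S := S))
        refine E.cut_left (insert a A) _ {a, A.inf id}
          (E.weaken Finset.subset_union_right subset_rfl (EntGenRel.ax _ _ (UpperAx.inf _ _))) ?_
        intro c hc
        simp only [Finset.mem_insert, Finset.mem_singleton] at hc
        rcases hc with rfl | rfl
        · exact E.of_mem (Finset.mem_insert_self _ _) (by simp)
        · exact E.weaken (Finset.subset_insert _ _) Finset.subset_union_right ih
    exact gen_trans _ key (gen_weaken _ subset_rfl (Finset.singleton_subset_iff.2 hb)
      (EntGenRel.ax _ _ (UpperAx.le _ b h)))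

theorem lower_rel_iff (A B : Finset S) :
    P.lower.rel A B ↔ ∃ a ∈ A, a ≤ B.sup id := by
  have h1 : P.lower.rel A B ↔ P.scott.rel B A := by
    rw [scott_eq_lower_dual]
    exact Iff.rfl
  rw [h1, scott_eq_dual_upper]
  exact P.dual.upper_rel_iff B A

theorem double_ll_iff (A B : Finset S) :
    P.double.ll A B ↔ ∃ a ∈ A, ∃ b ∈ B, P.prec a b := by
  constructor
  · rintro ⟨A', h, h'⟩
    obtain ⟨a', ha', b, hb, hab⟩ := (P.double_rel_iff A' B).1 h'
    obtain ⟨a, ha, haa'⟩ := h a' ha'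
    exact ⟨a, ha, b, hb, P.isProximityRel.up _ _ _ hab haa'⟩
  · rintro ⟨a, ha, b, hb, h⟩
    refine ⟨{b}, ?_, P.double.of_mem (Finset.mem_singleton_self b) hb⟩
    intro c hc
    rw [Finset.mem_singleton] at hc
    subst hc
    exact ⟨a, ha, h⟩

theorem upper_ll_iff (A B : Finset S) :
    P.upper.ll A B ↔ ∃ b ∈ B, P.prec (A.inf id) b := by
  constructor
  · rintro ⟨A', h, h'⟩
    obtain ⟨b, hb, hab⟩ := (P.upper_rel_iff A' B).1 h'
    refine ⟨b, hb, P.isProximityRel.up _ _ _ hab (P.isProximityRel.finset_inf fun a' ha' => ?_)⟩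
    obtain ⟨a, ha, haa'⟩ := h a' ha'
    exact P.isProximityRel.down _ _ _ (Finset.inf_le (f := id) ha) haa'
  · rintro ⟨b, hb, h⟩
    -- By continuity `≪` may be computed as `⊢` followed by `≺_L`; the meet of `A` is then the
    -- middle term, and no finite form of `prox_inf` is needed.
    refine (P.upper.cont A B).2
      ⟨{A.inf id}, (P.upper_rel_iff _ _).2 ⟨_, Finset.mem_singleton_self _, le_rfl⟩, ?_⟩
    intro c hc
    rw [Finset.mem_singleton] at hc
    subst hc
    exact ⟨b, hb, h⟩

theorem lower_ll_iff (A B : Finset S) :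
    P.lower.ll A B ↔ ∃ a ∈ A, P.prec a (B.sup id) := by
  have h1 : P.lower.ll A B ↔ P.scott.ll B A := by
    rw [scott_eq_lower_dual]
    exact (SContEnt.dual_ll _ _ _).symm
  rw [h1, scott_eq_dual_upper]
  exact P.dual.upper_ll_iff B A

/-! ### The lower powerlocale of the upper powerlocale. -/

/-- An element of `F(P_U(S))` is a join of generators. -/
theorem exists_sup_latGen_upper (t : P.upper.toEntRel.Lat) :
    ∃ B : Finset S, B.sup P.upper.latGen = t := by
  classical
  obtain ⟨U, rfl⟩ := P.upper.presents_toProxLat.exists_finEval t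
  -- Generators of `F(P_U(S))` preserve finite meets, so each meet of generators in the normal form
  -- collapses to a single generator.
  refine ⟨U.image fun A => A.inf id, ?_⟩
  rw [Finset.sup_image]
  refine Finset.sup_congr rfl fun A _ => ?_
  have h := P.upper.presents_toProxLat.rel_iff
  apply le_antisymm
  · refine Finset.le_inf fun a ha => ?_
    have h2 := (h {A.inf id} {a}).1 ((P.upper_rel_iff _ _).2
      ⟨a, by simp, by simpa using Finset.inf_le (f := id) ha⟩)
    simpa using h2
  · have h2 := (h A {A.inf id}).1 ((P.upper_rel_iff _ _).2 ⟨_, by simp, le_rfl⟩)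
    simpa using h2

/-- `P_L(P_U(S))` and `P_D(S)` present the same lattice. -/
theorem double_strictEquiv_lower_upper :
    SContEnt.StrictEquiv P.double P.upper.toProxLat.lower := by
  classical
  let Q := P.upper.toProxLat
  let η := P.upper.latGen
  let Z := Q.lower
  have hZ := Z.presents_toProxLat
  have hU := P.upper.presents_toProxLat
  have inf_comp : ∀ A : Finset S, A.inf (Z.latGen ∘ η) = (A.image η).inf Z.latGen := fun A =>
    (Finset.inf_image A η Z.latGen).symm
  have sup_comp : ∀ A : Finset S, A.sup (Z.latGen ∘ η) = (A.image η).sup Z.latGen := fun A =>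
    (Finset.sup_image A η Z.latGen).symm
  have sup_id : ∀ B : Finset S, (B.image η).sup id = B.sup η := fun B => Finset.sup_image B η id
  have inf_single : ∀ a : S, η a = ({a} : Finset S).inf η := fun a => by simp
  refine ⟨Z.latGen ∘ η, fun A B => ?_, fun A B => ?_, fun l => ?_⟩
  -- Both sides ask for some `a ∈ A`: on the lattice side `η a` lies below the join of `η` over `B`,
  -- which is `{a} ⊢_U B`, hence `a ≤ b` for some `b ∈ B`.
  · rw [inf_comp, sup_comp, ← hZ.rel_iff, Q.lower_rel_iff, sup_id, P.double_rel_iff,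
      Finset.exists_mem_image]
    refine exists_congr fun a => and_congr_right fun _ => ?_
    rw [inf_single, ← hU.rel_iff, P.upper_rel_iff]
    simp
  · rw [inf_comp, sup_comp, ← hZ.ll_iff, Q.lower_ll_iff, sup_id, P.double_ll_iff,
      Finset.exists_mem_image]
    refine exists_congr fun a => and_congr_right fun _ => ?_
    rw [inf_single, ← hU.ll_iff, P.upper_ll_iff]
    simp
  · obtain ⟨W, rfl⟩ := hZ.exists_finEval l
    choose σ hσ using P.exists_sup_latGen_upper
    -- Generators of the lower powerlocale preserve finite joins, so the decomposition of `t` into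
    -- elements `η b` passes to `Z.latGen t`.
    have gen : ∀ t, Z.latGen t = (σ t).sup (Z.latGen ∘ η) := fun t => by
      rw [sup_comp]
      apply le_antisymm
      · have := (hZ.rel_iff {t} ((σ t).image η)).1
          ((Q.lower_rel_iff _ _).2 ⟨t, by simp, by rw [sup_id, hσ]⟩)
        simpa using this
      · refine Finset.sup_le fun s hs => ?_
        obtain ⟨b, hb, rfl⟩ := Finset.mem_image.1 hs
        have := (hZ.rel_iff {η b} {t}).1 ((Q.lower_rel_iff _ _).2 ⟨η b, by simp, by
          rw [Finset.sup_singleton, id, ← hσ t]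
          exact Finset.le_sup hb⟩)
        simpa using this
    refine exists_finEval_sup _ fun C _ => exists_finEval_inf _ fun t _ => ?_
    rw [gen t]
    exact exists_finEval_sup _ fun a _ => ⟨{{a}}, by simp [finEval]⟩

/-! ### Transfer to the Scott constructions by duality. -/

theorem lower_scott_strictEquiv :
    SContEnt.StrictEquiv P.scott.toProxLat.lower (@double Sᵒᵈ _ _ P.dual : SContEnt S) := by
  rw [scott_eq_dual_upper]
  exact P.dual.double_strictEquiv_lower_upper.symm

theorem scott_upper_strictEquiv :
    SContEnt.StrictEquiv P.upper.toProxLat.scott (@double Sᵒᵈ _ _ P.dual : SContEnt S) := by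
  rw [scott_eq_lower_dual, ← double_dual_eq]
  exact P.double_strictEquiv_lower_upper.symm.dual

theorem scott_scott_strictEquiv :
    SContEnt.StrictEquiv P.scott.toProxLat.scott P.double := by
  rw [scott_eq_dual_upper]
  -- The double dual of `P` is `P` by unfolding, so the target is `P.double`.
  exact P.dual.scott_upper_strictEquiv

end StrongProxLat

theorem mainTheorem6 {S : Type u} [DistribLattice S] [BoundedOrder S] (P : StrongProxLat S) :
    SContEnt.Isomorphic P.scott.toProxLat.lower P.upper.toProxLat.scott ∧
    SContEnt.Isomorphic P.upper.toProxLat.lower P.double ∧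
    SContEnt.Isomorphic P.double.dual P.dual.double ∧
    SContEnt.Isomorphic P.scott.toProxLat.scott.dual P.dual.scott.toProxLat.scott := by
  refine ⟨(P.lower_scott_strictEquiv.trans P.scott_upper_strictEquiv.symm).isomorphic,
    P.double_strictEquiv_lower_upper.symm.isomorphic, ?_, ?_⟩
  · rw [P.double_dual_eq]
    exact (SContEnt.strictEquiv_refl P.dual.double).isomorphic
  · have h := P.scott_scott_strictEquiv.dual
    rw [P.double_dual_eq] at h
    exact (h.trans P.dual.scott_scott_strictEquiv.symm).isomorphic
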